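/- For an integer $m \ge 0$ let $K_m$ be the set of concave sequences in $\mathbb{R}^m$, that is, of all $\theta \in \mathbb{R}^m$ with $\theta_i - \theta_{i-1} \ge \theta_{i+1} - \theta_i$ whenever $2 \le i \le m-1$. For $n \ge 1$ let $K3 \subset \mathbb{R}^n$ be the set of all $\theta \in \mathbb{R}^n$ for which there are integers $0 \le m_1 < m_2 \le n+1$ with $(\theta_1,\dots,\theta_{m_1}) \in K_{m_1}$, $(\theta_{m_1+1},\dots,\theta_{m_2-1}) \in K_{m_2-m_1-1}$ and $(\theta_{m_2},\dots,\theta_n) \in K_{n-m_2+1}$, where any of these blocks may be empty. For $A \subset \mathbb{R}^n$ and $\epsilon > 0$ let $N(\epsilon, A)$ be the minimum number of closed Euclidean balls of radius $\epsilon$ with centers in $A$ that are needed to cover $A$. Then there is a universal constant $C > 0$ such that, for every integer $n \ge 1$, every real $B \ge 0$ and every $\epsilon > 0$, the number $N\big(\epsilon, \{\theta \in K3 : \max_{1 \le i \le n} |\theta_i| \le B\}\big)$ is finite and $$\log N\Big(\epsilon, \big\{\theta \in K3 : \max_{1 \le i \le n} |\theta_i| \le B\big\}\Big) \le C\, n^{1/4}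 \Big(\frac{B}{\epsilon}\Big)^{1/2} + 2 \log(n+2).$$ -/

import Mathlib

open scoped NNReal

/-- The set `K_n` of concave sequences `θ ∈ ℝⁿ`, i.e. those with
`θ_i - θ_{i-1} ≥ θ_{i+1} - θ_i` whenever `2 ≤ i ≤ n - 1`.
(Entries are indexed from `0` here; every sequence of length at most `2` is concave.) -/
def concaveSeqs (n : ℕ) : Set (EuclideanSpace ℝ (Fin n)) :=
  {θ | ∀ (j : ℕ) (hj : j + 2 < n),
    θ ⟨j + 2, hj⟩ - θ ⟨j + 1, by omega⟩ ≤ θ ⟨j + 1, by omega⟩ - θ ⟨j, by omega⟩}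

/-- The block of `θ` that consists of the `ℓ` consecutive entries following the first `a` ones;
with entries numbered from `1`, this is `(θ_{a+1}, …, θ_{a+ℓ})`. -/
def seqBlock {n : ℕ} (θ : EuclideanSpace ℝ (Fin n)) (a ℓ : ℕ) (h : a + ℓ ≤ n) :
    EuclideanSpace ℝ (Fin ℓ) :=
  WithLp.toLp 2 fun j : Fin ℓ => θ ⟨a + j, by omega⟩

/-- The set of sequences in `ℝⁿ` with at most three concave blocks: for some integers
`0 ≤ m₁ < m₂ ≤ n + 1`, the blocks `(θ_1, …, θ_{m₁})`, `(θ_{m₁+1}, …, θ_{m₂-1})` and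
`(θ_{m₂}, …, θ_n)`, of lengths `m₁`, `m₂ - m₁ - 1` and `n - m₂ + 1`, are concave.
Each of the blocks may be empty. -/
def threeBlockConcaveSeqs (n : ℕ) : Set (EuclideanSpace ℝ (Fin n)) :=
  {θ | ∃ (m₁ m₂ : ℕ) (_ : m₁ < m₂) (_ : m₂ ≤ n + 1),
    seqBlock θ 0 m₁ (by omega) ∈ concaveSeqs m₁ ∧
    seqBlock θ m₁ (m₂ - m₁ - 1) (by omega) ∈ concaveSeqs (m₂ - m₁ - 1) ∧
    seqBlock θ (m₂ - 1) (n + 1 - m₂) (by omega) ∈ concaveSeqs (n + 1 - m₂)}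

/-- The sequences with at most three concave blocks whose entries all lie in `[-B, B]`. -/
def boundedThreeBlockConcaveSeqs (n : ℕ) (B : ℝ) : Set (EuclideanSpace ℝ (Fin n)) :=
  {θ | θ ∈ threeBlockConcaveSeqs n ∧ ∀ i, |θ i| ≤ B}

/-! Covers are replaced by labellings (`HasCode`): one representative per used label gives centers
inside the set, and costs of combined labellings add.

Sup norm, Lipschitz case (`hasCode_steepConcave`): a concave sequence is determined by its end
values and its midpoint deviations at dyadic scales. These deviations are nonnegative and at level
`l` sum to at most `D / 2 ^ l`. Rounding them and counting integer vectors of bounded sum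
(`HasCode.of_sum_le`) costs an amount decaying geometrically away from the level `J` with `4 ^ J ≈ D
/ η`, in total `O(√(D / η))`.

Bounded case (`hasCode_half`, `hasCode_concaveUpTo`): without a Lipschitz bound, slopes at distance
about `2 ^ i` from an end are still `O(B / 2 ^ i)`, so each dyadic block falls under the Lipschitz
case. Shorter blocks tolerate a larger sup error in the Euclidean norm, which makes the costs
summable, with total `O(√(B √n / δ))`.

Three blocks multiply the constant; the choice of `(m₁, m₂)` yields `2 log (n + 2)`. -/

theorem sum_pow_le_inv {ρ : ℝ} (h0 : 0 ≤ ρ) (h1 : ρ < 1) (n : ℕ) :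
    ∑ i ∈ Finset.range n, ρ ^ i ≤ (1 - ρ)⁻¹ := by
  rw [← tsum_geometric_of_lt_one h0 h1]
  exact (summable_geometric_of_lt_one h0 h1).sum_le_tsum _ fun _ _ => by positivity

/-! ### Labellings and their costs -/

/-- `HasCode A R H`: the elements of `A` can be labelled with at most `exp H` labels in such a way
that any two elements with the same label are related by `R`. -/
def HasCode {X : Type*} (A : Set X) (R : X → X → Prop) (H : ℝ) : Prop :=
  ∃ (ι : Type) (S : Finset ι) (c : X → ι), (∀ x ∈ A, c x ∈ S) ∧ (S.card : ℝ) ≤ Real.exp H ∧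
    ∀ x ∈ A, ∀ y ∈ A, c x = c y → R x y

namespace HasCode

variable {X Y : Type*} {A : Set X} {R R' : X → X → Prop} {H H' : ℝ}

theorem mono (h : HasCode A R H) (hR : ∀ x ∈ A, ∀ y ∈ A, R x y → R' x y) (hH : H ≤ H') :
    HasCode A R' H' := by
  obtain ⟨ι, S, c, hc, hS, hcR⟩ := h
  exact ⟨ι, S, c, hc, hS.trans (Real.exp_le_exp.2 hH),
    fun x hx y hy hxy => hR x hx y hy (hcR x hx y hy hxy)⟩

theorem comap (h : HasCode A R H) {A' : Set Y} (f : Y → X) (hf : ∀ y ∈ A', f y ∈ A) :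
    HasCode A' (fun x y => R (f x) (f y)) H := by
  obtain ⟨ι, S, c, hc, hS, hcR⟩ := h
  exact ⟨ι, S, fun y => c (f y), fun y hy => hc _ (hf y hy), hS,
    fun x hx y hy hxy => hcR _ (hf x hx) _ (hf y hy) hxy⟩

theorem of_forall (h : ∀ x ∈ A, ∀ y ∈ A, R x y) (hH : 0 ≤ H) : HasCode A R H :=
  ⟨Unit, {()}, fun _ => (), by simp, by simpa using hH, fun x hx y hy _ => h x hx y hy⟩

theorem and (h : HasCode A R H) (h' : HasCode A R' H') :
    HasCode A (fun x y => R x y ∧ R' x y) (H + H') := by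
  obtain ⟨ι, S, c, hc, hS, hcR⟩ := h
  obtain ⟨ι', S', c', hc', hS', hcR'⟩ := h'
  refine ⟨ι × ι', S ×ˢ S', fun x => (c x, c' x),
    fun x hx => Finset.mk_mem_product (hc x hx) (hc' x hx), ?_, fun x hx y hy hxy => ?_⟩
  · rw [Finset.card_product, Nat.cast_mul, Real.exp_add]
    gcongr
  · simp only [Prod.mk.injEq] at hxy
    exact ⟨hcR x hx y hy hxy.1, hcR' x hx y hy hxy.2⟩

theorem forall_lt {n : ℕ} {R : ℕ → X → X → Prop} {H : ℕ → ℝ}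
    (h : ∀ i < n, HasCode A (R i) (H i)) :
    HasCode A (fun x y => ∀ i < n, R i x y) (∑ i ∈ Finset.range n, H i) := by
  induction n with
  | zero => exact of_forall (by simp) (by simp)
  | succ n ih =>
    rw [Finset.sum_range_succ]
    refine ((ih fun i hi => h i (by omega)).and (h n (by omega))).mono ?_ le_rfl
    rintro x - y - ⟨h1, h2⟩ i hi
    rcases Nat.lt_succ_iff_lt_or_eq.1 hi with hi | rfl
    exacts [h1 i hi, h2]

/-- Integer vectors of length `N` with nonnegative entries and bounded sum, counted by means of
their generating function. -/
theorem of_sum_le (q : X → ℕ → ℕ) (N : ℕ) (S y : ℝ) (hy : 0 < y)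
    (hq : ∀ x ∈ A, (∑ k ∈ Finset.range N, (q x k : ℝ)) ≤ S) :
    HasCode A (fun x x' => ∀ k < N, q x k = q x' k)
      (S * Real.log (1 + 1 / y) + N * Real.log (1 + y)) := by
  have hy1 : 0 < 1 + 1 / y := by positivity
  have hbase : 1 ≤ 1 + 1 / y := by simp only [le_add_iff_nonneg_right]; positivity
  have hinv : (1 + 1 / y)⁻¹ = y / (1 + y) := by field_simp; ring
  -- Each admissible vector has weight `(1 + 1/y)^S * x0^(∑ p) ≥ 1`; summed over all vectors, the
  -- weights factor into geometric series, each at most `1 / (1 - x0) = 1 + y`.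
  set x0 : ℝ := (1 + 1 / y)⁻¹ with hx0
  have hx0pos : 0 ≤ x0 := by positivity
  have hx01 : x0 < 1 := by rw [hinv, div_lt_one (by positivity)]; linarith
  classical
  refine ⟨Fin N → ℕ,
    (Fintype.piFinset fun _ : Fin N => Finset.range (⌊S⌋₊ + 1)).filter
      (fun p => (∑ k, (p k : ℝ)) ≤ S), fun x k => q x k, fun x hx => ?_, ?_,
      fun x _ x' _ hxx k hk => congrFun hxx ⟨k, hk⟩⟩
  · have hs : (∑ k : Fin N, (q x k : ℝ)) ≤ S := by
      rw [Fin.sum_univ_eq_sum_range (fun k => (q x k : ℝ))]; exact hq x hx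
    simp only [Finset.mem_filter, Fintype.mem_piFinset, Finset.mem_range]
    refine ⟨fun k => Nat.lt_succ_of_le (Nat.le_floor (le_trans ?_ hs)), hs⟩
    exact Finset.single_le_sum (f := fun k : Fin N => (q x k : ℝ))
      (fun _ _ => Nat.cast_nonneg _) (Finset.mem_univ k)
  · have hgeom : ∑ j ∈ Finset.range (⌊S⌋₊ + 1), x0 ^ j ≤ 1 + y := by
      refine (sum_pow_le_inv hx0pos hx01 _).trans (le_of_eq ?_)
      rw [hinv]; field_simp; ring
    rw [Real.exp_add, mul_comm S, mul_comm (N : ℝ), ← Real.rpow_def_of_pos hy1,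
      ← Real.rpow_def_of_pos (by positivity), Real.rpow_natCast]
    calc _ = ∑ p ∈ (Fintype.piFinset fun _ : Fin N => Finset.range (⌊S⌋₊ + 1)).filter
          (fun p => (∑ k, (p k : ℝ)) ≤ S), (1 : ℝ) := by simp
      _ ≤ ∑ p ∈ (Fintype.piFinset fun _ : Fin N => Finset.range (⌊S⌋₊ + 1)).filter
          (fun p => (∑ k, (p k : ℝ)) ≤ S), (1 + 1 / y) ^ S * ∏ k, x0 ^ p k := by
        refine Finset.sum_le_sum fun p hp => ?_
        have hp2 := (Finset.mem_filter.1 hp).2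
        rw [Finset.prod_pow_eq_pow_sum, hx0, inv_pow, ← div_eq_mul_inv,
          one_le_div (by positivity), ← Real.rpow_natCast]
        exact Real.rpow_le_rpow_of_exponent_le hbase (by push_cast; exact hp2)
      _ ≤ ∑ p ∈ Fintype.piFinset fun _ : Fin N => Finset.range (⌊S⌋₊ + 1),
          (1 + 1 / y) ^ S * ∏ k, x0 ^ p k :=
        Finset.sum_le_sum_of_subset_of_nonneg (Finset.filter_subset _ _)
          fun _ _ _ => by positivity
      _ = (1 + 1 / y) ^ S * (∑ j ∈ Finset.range (⌊S⌋₊ + 1), x0 ^ j) ^ N := by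
        rw [← Finset.mul_sum, Finset.sum_prod_piFinset (Finset.range (⌊S⌋₊ + 1))
          (fun (_ : Fin N) j => x0 ^ j)]
        simp
      _ ≤ _ := by gcongr

end HasCode

/-- Gives scalar rounding the same square-root cost as everything else, with no additive constant.
-/
theorem log_one_add_le_two_mul_sqrt {u : ℝ} (hu : 0 ≤ u) : Real.log (1 + u) ≤ 2 * √u := by
  have h1 : 1 + u ≤ (1 + √u) ^ 2 := by nlinarith [Real.sq_sqrt hu, Real.sqrt_nonneg u]
  have h2 : Real.log (1 + √u) ≤ √u := by
    have := Real.log_le_sub_one_of_pos (show 0 < 1 + √u by positivity); linarith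
  calc Real.log (1 + u) ≤ Real.log ((1 + √u) ^ 2) := Real.log_le_log (by positivity) h1
    _ = 2 * Real.log (1 + √u) := by rw [Real.log_pow]; norm_num
    _ ≤ _ := by linarith

theorem abs_sub_le_of_floor_div_eq {a b η : ℝ} (hη : 0 < η) (ha : 0 ≤ a) (hb : 0 ≤ b)
    (h : ⌊a / η⌋₊ = ⌊b / η⌋₊) : |a - b| ≤ η := by
  have a1 := Nat.floor_le (div_nonneg ha hη.le)
  have a2 := Nat.lt_floor_add_one (a / η)
  have b1 := Nat.floor_le (div_nonneg hb hη.le)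
  have b2 := Nat.lt_floor_add_one (b / η)
  rw [h] at a1 a2
  have h3 : |a / η - b / η| ≤ 1 := by rw [abs_le]; constructor <;> linarith
  rwa [← sub_div, abs_div, abs_of_pos hη, div_le_one hη] at h3

/-- Rounding of a bounded real quantity. -/
theorem HasCode.of_abs_le {X : Type*} {A : Set X} (v : X → ℝ) {B η : ℝ} (hB : 0 ≤ B) (hη : 0 < η)
    (hv : ∀ x ∈ A, |v x| ≤ B) :
    HasCode A (fun x y => |v x - v y| ≤ η) (2 * √(2 * B / η)) := by
  refine ⟨ℕ, Finset.range (⌊2 * B / η⌋₊ + 1), fun x => ⌊(v x + B) / η⌋₊, fun x hx => ?_, ?_,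
    fun x hx y hy hxy => ?_⟩
  · rw [Finset.mem_range, Nat.lt_succ_iff]
    refine Nat.floor_le_floor (div_le_div_of_nonneg_right ?_ hη.le)
    linarith [(abs_le.1 (hv x hx)).2]
  · have hu : 0 ≤ 2 * B / η := by positivity
    rw [← Real.log_le_iff_le_exp (by simp; positivity)]
    refine le_trans (Real.log_le_log (by simp; positivity) ?_) (log_one_add_le_two_mul_sqrt hu)
    simp only [Finset.card_range, Nat.cast_add, Nat.cast_one]
    linarith [Nat.floor_le hu]
  · have := abs_sub_le_of_floor_div_eq hη (by linarith [(abs_le.1 (hv x hx)).1])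
      (by linarith [(abs_le.1 (hv y hy)).1]) hxy
    simpa using this

theorem sum_pow_sub_le {ρ : ℝ} (h0 : 0 ≤ ρ) (h1 : ρ < 1) (n : ℕ) :
    ∑ i ∈ Finset.range n, ρ ^ (n - i) ≤ (1 - ρ)⁻¹ := by
  rw [← Finset.sum_range_reflect]
  refine le_trans (Finset.sum_le_sum fun i hi => ?_) (sum_pow_le_inv h0 h1 n)
  have := Finset.mem_range.1 hi
  exact pow_le_pow_of_le_one h0 h1.le (by omega)

/-- With truncated subtraction, the exponent is `|l - J|`. -/
theorem sum_pow_dist_le {ρ : ℝ} (h0 : 0 ≤ ρ) (h1 : ρ < 1) (n J : ℕ) :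
    ∑ l ∈ Finset.range n, ρ ^ ((l - J) + (J - l)) ≤ 2 * (1 - ρ)⁻¹ := by
  calc _ ≤ ∑ l ∈ Finset.range (J + n), ρ ^ ((l - J) + (J - l)) :=
        Finset.sum_le_sum_of_subset_of_nonneg
          (Finset.range_subset_range.2 (by omega)) fun _ _ _ => by positivity
    _ = ∑ l ∈ Finset.range J, ρ ^ (J - l) + ∑ i ∈ Finset.range n, ρ ^ i := by
        rw [Finset.sum_range_add]
        congr 1
        · refine Finset.sum_congr rfl fun l hl => ?_
          have := Finset.mem_range.1 hl
          rw [show l - J + (J - l) = J - l by omega]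
        · refine Finset.sum_congr rfl fun l _ => ?_
          rw [show J + l - J + (J - (J + l)) = l by omega]
    _ ≤ _ := by linarith [sum_pow_sub_le h0 h1 J, sum_pow_le_inv h0 h1 n]

/-! ### Dyadic midpoint deviations of Lipschitz concave sequences -/

/-- The deviation of `g` at the midpoint of `[2kL, (2k+2)L]` from the mean of the end values. -/
noncomputable def midDev (g : ℕ → ℝ) (L k : ℕ) : ℝ :=
  g ((2 * k + 1) * L) - (g (2 * k * L) + g ((2 * k + 2) * L)) / 2

/-- Concave sequences whose total variation over `2 ^ n` steps is controlled by `D`. -/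
def steepConcave (n : ℕ) (D : ℝ) : Set (ℕ → ℝ) :=
  {g | Antitone (fun k => g (k + 1) - g k) ∧ (∀ k, |g (k + 1) - g k| * 2 ^ n ≤ D) ∧ |g 0| ≤ D}

theorem antitone_increment {g : ℕ → ℝ} (hg : Antitone fun k => g (k + 1) - g k) (L : ℕ) :
    Antitone fun k => g (k + L) - g k := by
  induction L with
  | zero => intro a b _; simp
  | succ L ih =>
    intro a b hab
    have h1 := ih hab
    have h2 := hg (show a + L ≤ b + L by omega)
    simp only [← add_assoc] at h1 h2 ⊢
    linarith

theorem abs_increment_le {g : ℕ → ℝ} {n : ℕ} {D : ℝ} (hg : ∀ k, |g (k + 1) - g k| * 2 ^ n ≤ D)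
    (L a : ℕ) : |g (a + L) - g a| * 2 ^ n ≤ L * D := by
  induction L with
  | zero => simp
  | succ L ih =>
    have h2 := hg (a + L)
    have h3 : |g (a + (L + 1)) - g a| ≤ |g (a + L + 1) - g (a + L)| + |g (a + L) - g a| := by
      rw [← add_assoc]; exact abs_sub_le _ _ _
    have h4 := mul_le_mul_of_nonneg_right h3 (show (0 : ℝ) ≤ 2 ^ n by positivity)
    push_cast
    linarith

theorem midDev_eq (g : ℕ → ℝ) (L k : ℕ) :
    midDev g L k = ((g (2 * k * L + L) - g (2 * k * L)) -
      (g ((2 * k + 1) * L + L) - g ((2 * k + 1) * L))) / 2 := by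
  rw [midDev, show (2 * k + 2) * L = (2 * k + 1) * L + L by ring,
    show (2 * k + 1) * L = 2 * k * L + L by ring]
  ring

theorem midDev_nonneg {g : ℕ → ℝ} (hg : Antitone fun k => g (k + 1) - g k) (L k : ℕ) :
    0 ≤ midDev g L k := by
  rw [midDev_eq]
  have := antitone_increment hg L (show 2 * k * L ≤ (2 * k + 1) * L by gcongr; omega)
  simp only at this
  linarith

/-- The deviations are half the drops between the two increments of each pair; adding the
nonnegative drops between consecutive pairs makes the sum telescope. -/
theorem sum_midDev_le {g : ℕ → ℝ} (hg : Antitone fun k => g (k + 1) - g k) (L N : ℕ) :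
    ∑ k ∈ Finset.range N, midDev g L k ≤
      ((g L - g 0) - (g (2 * N * L + L) - g (2 * N * L))) / 2 := by
  induction N with
  | zero => simp
  | succ N ih =>
    rw [Finset.sum_range_succ, midDev_eq]
    have := antitone_increment hg L (show (2 * N + 1) * L ≤ 2 * (N + 1) * L by gcongr; omega)
    simp only at this
    linarith

theorem sum_midDev_le_of_mem {g : ℕ → ℝ} {n l : ℕ} {D : ℝ} (hl : l < n)
    (hg : g ∈ steepConcave n D) (N : ℕ) :
    ∑ k ∈ Finset.range N, midDev g (2 ^ (n - l - 1)) k ≤ D / 2 ^ l := by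
  obtain ⟨h1, h2, h3⟩ := hg
  have hD : 0 ≤ D := (abs_nonneg _).trans h3
  set L := 2 ^ (n - l - 1) with hL
  have hn : (2 : ℝ) ^ n = L * 2 * 2 ^ l := by
    rw [hL]; push_cast
    rw [← pow_succ, ← pow_add]; congr 1; omega
  have a := abs_increment_le h2 L 0
  have b := abs_increment_le h2 L (2 * N * L)
  have hLpos : (0 : ℝ) < L := by rw [hL]; positivity
  have key : ∀ z : ℝ, |z| * 2 ^ n ≤ L * D → |z| ≤ D / 2 ^ l / 2 := by
    intro z hz
    rw [hn] at hz
    rw [div_div, le_div_iff₀ (by positivity)]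
    refine le_of_mul_le_mul_left ?_ hLpos
    linarith
  have a' := abs_le.1 (key _ a)
  have b' := abs_le.1 (key _ b)
  refine (sum_midDev_le h1 L N).trans ?_
  rw [zero_add] at a'
  have : 0 ≤ D / 2 ^ l := by positivity
  linarith

/-- A sequence is controlled by its end values and its midpoint deviations at all dyadic scales. -/
theorem abs_le_of_midDev_le {d : ℕ → ℝ} {n : ℕ} {r : ℝ} {τ : ℕ → ℝ} (h0 : |d 0| ≤ r)
    (h1 : |d (2 ^ n)| ≤ r) (hτ : ∀ l < n, 0 ≤ τ l)
    (hd : ∀ l < n, ∀ k < 2 ^ l, |midDev d (2 ^ (n - l - 1)) k| ≤ τ l) :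
    ∀ l ≤ n, ∀ k ≤ 2 ^ l, |d (k * 2 ^ (n - l))| ≤ r + ∑ i ∈ Finset.range l, τ i := by
  intro l
  induction l with
  | zero =>
    intro _ k hk
    rw [pow_zero] at hk
    interval_cases k <;> simpa
  | succ l ih =>
    intro hl k hk
    have hl' : l ≤ n := by omega
    have hL : 2 ^ (n - l) = 2 * 2 ^ (n - (l + 1)) := by rw [← pow_succ']; congr 1; omega
    rw [Finset.sum_range_succ]
    -- Even points belong to the coarser grid; at odd points the value is the mean of two coarser
    -- values plus one deviation.
    obtain ⟨m, rfl | rfl⟩ := Nat.even_or_odd' k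
    · have := ih hl' m (by rw [pow_succ] at hk; omega)
      rw [hL] at this
      rw [show 2 * m * 2 ^ (n - (l + 1)) = m * (2 * 2 ^ (n - (l + 1))) by ring]
      linarith [hτ l (by omega)]
    · have hm : m < 2 ^ l := by rw [pow_succ] at hk; omega
      have a := ih hl' m hm.le
      have b := ih hl' (m + 1) hm
      have c := hd l (by omega) m hm
      rw [hL] at a b
      rw [midDev, show n - l - 1 = n - (l + 1) by omega,
        show 2 * m * 2 ^ (n - (l + 1)) = m * (2 * 2 ^ (n - (l + 1))) by ring,
        show (2 * m + 2) * 2 ^ (n - (l + 1)) = (m + 1) * (2 * 2 ^ (n - (l + 1))) by ring] at c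
      rw [abs_le] at a b c ⊢
      constructor <;> linarith [a.1, a.2, b.1, b.2, c.1, c.2]

theorem midDev_sub (g g' : ℕ → ℝ) (L k : ℕ) :
    midDev (fun i => g i - g' i) L k = midDev g L k - midDev g' L k := by
  simp only [midDev]; ring

theorem hasCode_midDev {n l : ℕ} {D η y S : ℝ} (hl : l < n) (hη : 0 < η) (hy : 0 < y)
    (hS : D / 2 ^ l / η ≤ S) :
    HasCode (steepConcave n D)
      (fun g g' => ∀ k < 2 ^ l, |midDev (fun i => g i - g' i) (2 ^ (n - l - 1)) k| ≤ η)
      (S * Real.log (1 + 1 / y) + 2 ^ l * Real.log (1 + y)) := by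
  have := HasCode.of_sum_le (A := steepConcave n D)
    (fun g k => ⌊midDev g (2 ^ (n - l - 1)) k / η⌋₊) (2 ^ l) S y hy ?_
  · refine this.mono (fun g hg g' hg' h k hk => ?_) (by push_cast; exact le_rfl)
    rw [midDev_sub]
    exact abs_sub_le_of_floor_div_eq hη (midDev_nonneg hg.1 _ _) (midDev_nonneg hg'.1 _ _) (h k hk)
  · intro g hg
    refine le_trans ?_ hS
    calc _ ≤ ∑ k ∈ Finset.range (2 ^ l), midDev g (2 ^ (n - l - 1)) k / η :=
          Finset.sum_le_sum fun k _ => Nat.floor_le (div_nonneg (midDev_nonneg hg.1 _ _) hη.le)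
      _ ≤ _ := by
          rw [← Finset.sum_div]
          exact div_le_div_of_nonneg_right (sum_midDev_le_of_mem hl hg _) hη.le

/-! ### Cost of each dyadic level, and the sup-norm bound -/

theorem log_one_add_pow_le {b : ℝ} (c : ℕ) (hb1 : 1 ≤ b) (hb : b ≤ 2 ^ c) (i : ℕ) :
    Real.log (1 + b ^ i) ≤ 1 + c * i := by
  have h1 : 1 + b ^ i ≤ 2 ^ (1 + c * i) := by
    have : b ^ i ≤ (2 ^ c) ^ i := by gcongr
    rw [pow_add, pow_one, pow_mul]
    have := one_le_pow₀ (M₀ := ℝ) (n := i) (a := 2 ^ c) (one_le_pow₀ (by norm_num))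
    linarith
  have h2 := Real.log_le_log (by positivity) h1
  rw [Real.log_pow] at h2
  refine h2.trans ?_
  have h3 : Real.log 2 ≤ 1 := by linarith [Real.log_two_lt_d9]
  push_cast
  have : (0 : ℝ) ≤ 1 + c * i := by positivity
  nlinarith

/-- Level `J + i`, `T = 2 ^ J`: the rounded vectors are sparse, hence a small `y = 3⁻ⁱ`. The factor
`(5/4)^i` absorbs the linear growth of the logarithm. -/
theorem levelCost_fine (T : ℝ) (hT : 0 ≤ T) (i : ℕ) :
    64 * T * (2 / 3) ^ i * Real.log (1 + 1 / ((1 / 3 : ℝ) ^ i)) +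
      T * 2 ^ i * Real.log (1 + (1 / 3 : ℝ) ^ i) ≤ 600 * T * (5 / 6) ^ i := by
  have h1 : Real.log (1 + 1 / ((1 / 3 : ℝ) ^ i)) ≤ 1 + 2 * i := by
    have := log_one_add_pow_le (b := 3) 2 (by norm_num) (by norm_num) i
    simpa using this
  have h2 : Real.log (1 + (1 / 3 : ℝ) ^ i) ≤ (1 / 3 : ℝ) ^ i := by
    have := Real.log_le_sub_one_of_pos (show 0 < 1 + (1 / 3 : ℝ) ^ i by positivity); linarith
  have h3 : (1 + 2 * i : ℝ) ≤ 8 * (5 / 4) ^ i := by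
    have := one_add_mul_le_pow (show (-2 : ℝ) ≤ 1 / 4 by norm_num) i
    norm_num at this
    linarith
  have h4 : (2 / 3 : ℝ) ^ i * (5 / 4) ^ i = (5 / 6) ^ i := by rw [← mul_pow]; norm_num
  have h5 : (2 : ℝ) ^ i * (1 / 3) ^ i = (2 / 3) ^ i := by rw [← mul_pow]; norm_num
  have h6 : (2 / 3 : ℝ) ^ i ≤ (5 / 6) ^ i :=
    pow_le_pow_left₀ (by norm_num) (by norm_num) i
  calc _ ≤ 64 * T * (2 / 3) ^ i * (8 * (5 / 4) ^ i) + T * 2 ^ i * (1 / 3 : ℝ) ^ i := by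
        gcongr; exact h1.trans h3
    _ = 512 * T * (5 / 6) ^ i + T * (2 / 3) ^ i := by rw [← h4, ← h5]; ring
    _ ≤ 512 * T * (5 / 6) ^ i + T * (5 / 6) ^ i := by gcongr
    _ ≤ _ := by have : 0 ≤ T * (5 / 6) ^ i := by positivity
                linarith

/-- Level `J - i`: few coordinates with large entries, hence a large `y = 8ⁱ`. -/
theorem levelCost_coarse (T : ℝ) (hT : 0 ≤ T) (i : ℕ) :
    64 * T * (8 / 3) ^ i * Real.log (1 + 1 / ((8 : ℝ) ^ i)) +
      T / 2 ^ i * Real.log (1 + (8 : ℝ) ^ i) ≤ 600 * T * (5 / 6) ^ i := by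
  have h1 : Real.log (1 + (8 : ℝ) ^ i) ≤ 1 + 3 * i := by
    have := log_one_add_pow_le (b := 8) 3 (by norm_num) (by norm_num) i
    simpa using this
  have h2 : Real.log (1 + 1 / (8 : ℝ) ^ i) ≤ 1 / (8 : ℝ) ^ i := by
    have := Real.log_le_sub_one_of_pos (show 0 < 1 + 1 / (8 : ℝ) ^ i by positivity); linarith
  have h3 : (1 + 3 * i : ℝ) ≤ 12 * (5 / 4) ^ i := by
    have := one_add_mul_le_pow (show (-2 : ℝ) ≤ 1 / 4 by norm_num) i
    norm_num at this
    linarith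
  have h4 : (5 / 4 : ℝ) ^ i / 2 ^ i = (5 / 8) ^ i := by rw [← div_pow]; norm_num
  have h5 : (8 / 3 : ℝ) ^ i * (1 / 8 ^ i) = (1 / 3) ^ i := by
    rw [mul_one_div, ← div_pow]; norm_num
  have h6 : (1 / 3 : ℝ) ^ i ≤ (5 / 6) ^ i :=
    pow_le_pow_left₀ (by norm_num) (by norm_num) i
  have h7 : (5 / 8 : ℝ) ^ i ≤ (5 / 6) ^ i :=
    pow_le_pow_left₀ (by norm_num) (by norm_num) i
  calc _ ≤ 64 * T * (8 / 3) ^ i * (1 / 8 ^ i) + T / 2 ^ i * (12 * (5 / 4) ^ i) := by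
        gcongr; exact h1.trans h3
    _ = 64 * T * (1 / 3) ^ i + 12 * T * (5 / 8) ^ i := by rw [← h4, ← h5]; ring
    _ ≤ 64 * T * (5 / 6) ^ i + 12 * T * (5 / 6) ^ i := by gcongr
    _ ≤ _ := by have : 0 ≤ T * (5 / 6) ^ i := by positivity
                linarith

/-- At level `J` a typical deviation is of size `D / 4 ^ J ≈ η`. The tolerances peak there and sum
to at most `η / 2`, the other half being left for the end values. -/
theorem hasCode_level {n l J : ℕ} {D η : ℝ} (hl : l < n) (hη : 0 < η)
    (hJ : D / η ≤ 4 * 4 ^ J) :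
    HasCode (steepConcave n D)
      (fun g g' => ∀ k < 2 ^ l, |midDev (fun i => g i - g' i) (2 ^ (n - l - 1)) k| ≤
        η / 16 * (3 / 4) ^ ((l - J) + (J - l)))
      (600 * 2 ^ J * (5 / 6) ^ ((l - J) + (J - l))) := by
  have h4 : (4 : ℝ) ^ J = 2 ^ J * 2 ^ J := by rw [← mul_pow]; norm_num
  have hS : ∀ i : ℕ, D / 2 ^ l / (η / 16 * (3 / 4) ^ i) ≤
      64 * (2 ^ J * 2 ^ J) / 2 ^ l * (4 / 3) ^ i := by
    intro i
    have e : D / 2 ^ l / (η / 16 * (3 / 4) ^ i) = 16 * (D / η) / 2 ^ l * (4 / 3) ^ i := by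
      rw [show (4 / 3 : ℝ) = (3 / 4)⁻¹ by norm_num, inv_pow]
      field_simp
    rw [e]
    gcongr ?_ / 2 ^ l * (4 / 3) ^ i
    linarith
  rcases le_total J l with h | h
  · obtain ⟨i, rfl⟩ := Nat.exists_eq_add_of_le h
    rw [show J + i - J + (J - (J + i)) = i by omega]
    refine (hasCode_midDev (S := 64 * 2 ^ J * (2 / 3) ^ i) (y := (1 / 3) ^ i) hl (by positivity)
      (by positivity) ((hS i).trans (le_of_eq ?_))).mono (fun _ _ _ _ h => h) ?_
    · rw [show (2 / 3 : ℝ) ^ i = (4 / 3) ^ i / 2 ^ i by rw [← div_pow]; norm_num, pow_add]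
      field_simp
    · rw [pow_add]
      exact levelCost_fine (2 ^ J) (by positivity) i
  · obtain ⟨i, rfl⟩ := Nat.exists_eq_add_of_le h
    rw [show l - (l + i) + (l + i - l) = i by omega]
    refine (hasCode_midDev (S := 64 * 2 ^ (l + i) * (8 / 3) ^ i) (y := 8 ^ i) hl (by positivity)
      (by positivity) ((hS i).trans (le_of_eq ?_))).mono (fun _ _ _ _ h => h) ?_
    · rw [show (8 / 3 : ℝ) ^ i = (4 / 3) ^ i * 2 ^ i by rw [← mul_pow]; norm_num, pow_add]
      field_simp
    · refine le_trans (le_of_eq ?_) (levelCost_coarse (2 ^ (l + i)) (by positivity) i)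
      rw [show (2 : ℝ) ^ (l + i) / 2 ^ i = 2 ^ l by rw [pow_add]; field_simp]

theorem abs_le_two_mul {n : ℕ} {D : ℝ} {g : ℕ → ℝ} (hg : g ∈ steepConcave n D) {k : ℕ}
    (hk : k ≤ 2 ^ n) : |g k| ≤ 2 * D := by
  obtain ⟨-, h2, h3⟩ := hg
  have hD : 0 ≤ D := (abs_nonneg _).trans h3
  have h := abs_increment_le h2 k 0
  rw [zero_add] at h
  have hk' : (k : ℝ) ≤ 2 ^ n := by exact_mod_cast hk
  have : |g k - g 0| ≤ D := by
    refine le_of_mul_le_mul_right (h.trans ?_) (show (0 : ℝ) < 2 ^ n by positivity)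
    nlinarith
  have := abs_sub_abs_le_abs_sub (g k) (g 0)
  linarith

theorem hasCode_steepConcave_of_le {n : ℕ} {D η : ℝ} (hη : 0 < η) (hD : η ≤ D) :
    HasCode (steepConcave n D) (fun g g' => ∀ k ≤ 2 ^ n, |g k - g' k| ≤ η)
      (7300 * √(D / η)) := by
  have hDpos : 0 < D := hη.trans_le hD
  obtain ⟨J, hJ1, hJ2⟩ := exists_nat_pow_near (x := D / η) (y := 4) ((one_le_div hη).2 hD)
    (by norm_num)
  have hJ : (2 : ℝ) ^ J ≤ √(D / η) := by
    refine Real.le_sqrt_of_sq_le (le_trans (le_of_eq ?_) hJ1)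
    rw [← pow_mul, mul_comm, pow_mul]; norm_num
  have hs : √(2 * (2 * D) / (η / 2)) ≤ 3 * √(D / η) := by
    rw [← Real.sqrt_sq (show (0 : ℝ) ≤ 3 by norm_num), ← Real.sqrt_mul (by norm_num)]
    refine Real.sqrt_le_sqrt ?_
    rw [show 2 * (2 * D) / (η / 2) = 8 * (D / η) by field_simp; ring]
    have : 0 ≤ D / η := by positivity
    linarith
  have e0 : HasCode (steepConcave n D) (fun g g' => |g 0 - g' 0| ≤ η / 2) (6 * √(D / η)) :=
    (HasCode.of_abs_le (fun g : ℕ → ℝ => g 0) (B := 2 * D) (by linarith) (half_pos hη)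
      fun g hg => abs_le_two_mul hg (by positivity)).mono (fun _ _ _ _ h => h) (by linarith)
  have e1 : HasCode (steepConcave n D) (fun g g' => |g (2 ^ n) - g' (2 ^ n)| ≤ η / 2)
      (6 * √(D / η)) :=
    (HasCode.of_abs_le (fun g : ℕ → ℝ => g (2 ^ n)) (B := 2 * D) (by linarith) (half_pos hη)
      fun g hg => abs_le_two_mul hg le_rfl).mono (fun _ _ _ _ h => h) (by linarith)
  have e2 := HasCode.forall_lt fun l (hl : l < n) =>
    hasCode_level hl hη (show D / η ≤ 4 * 4 ^ J by rw [← pow_succ']; exact hJ2.le)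
  refine ((e0.and e1).and e2).mono ?_ ?_
  · rintro g - g' - ⟨⟨h0, h1⟩, h2⟩ k hk
    have := abs_le_of_midDev_le (d := fun i => g i - g' i) h0 h1
      (fun l _ => by positivity) h2 n le_rfl k hk
    rw [Nat.sub_self, pow_zero, mul_one, ← Finset.mul_sum] at this
    have hsum := sum_pow_dist_le (ρ := 3 / 4) (by norm_num) (by norm_num) n J
    norm_num at hsum
    have := mul_le_mul_of_nonneg_left hsum (show 0 ≤ η / 16 by positivity)
    linarith
  · rw [← Finset.mul_sum]
    have hsum := sum_pow_dist_le (ρ := 5 / 6) (by norm_num) (by norm_num) n J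
    norm_num at hsum
    have := mul_le_mul_of_nonneg_left hsum (show (0 : ℝ) ≤ 600 * 2 ^ J by positivity)
    linarith [Real.sqrt_nonneg (D / η)]

theorem hasCode_steepConcave {n : ℕ} {D η : ℝ} (hη : 0 < η) :
    HasCode (steepConcave n D) (fun g g' => ∀ k ≤ 2 ^ n, |g k - g' k| ≤ η)
      (14600 * √(D / η)) := by
  -- If `η` is large, one label suffices since values are at most `2 * D`; otherwise enlarging `D`
  -- to `4 * D` only doubles the cost.
  rcases le_total (4 * D) η with h | h
  · refine HasCode.of_forall (fun g hg g' hg' k hk => ?_) (by positivity)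
    have := abs_le.1 (abs_le_two_mul hg hk)
    have := abs_le.1 (abs_le_two_mul hg' hk)
    rw [abs_le]
    constructor <;> linarith
  · have hs : √(4 * D / η) = 2 * √(D / η) := by
      rw [mul_div_assoc, Real.sqrt_mul (by norm_num), show (4 : ℝ) = 2 ^ 2 by norm_num,
        Real.sqrt_sq (by norm_num)]
    refine ((hasCode_steepConcave_of_le (n := n) hη h).comap id ?_).mono
      (fun _ _ _ _ h => h) (by rw [hs]; linarith)
    rintro g ⟨h1, h2, h3⟩
    exact ⟨h1, fun k => (h2 k).trans (by linarith), h3.trans (by linarith)⟩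

/-! ### From bounded to Lipschitz concave sequences -/

/-- Sequences that are concave and bounded by `B` on `{0, …, M}`. -/
def concaveUpTo (M : ℕ) (B : ℝ) : Set (ℕ → ℝ) :=
  {f | (∀ j, j + 2 ≤ M → f (j + 2) - f (j + 1) ≤ f (j + 1) - f j) ∧ ∀ k ≤ M, |f k| ≤ B}

theorem slope_anti {M : ℕ} {B : ℝ} {f : ℕ → ℝ} (hf : f ∈ concaveUpTo M B) {a b : ℕ} (hab : a ≤ b)
    (hb : b < M) : f (b + 1) - f b ≤ f (a + 1) - f a := by
  induction b, hab using Nat.le_induction with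
  | base => exact le_rfl
  | succ b _ ih => exact (hf.1 b (by omega)).trans (ih (by omega))

theorem increment_le_mul_slope {M : ℕ} {B : ℝ} {f : ℕ → ℝ} (hf : f ∈ concaveUpTo M B) {a c : ℕ}
    (hca : c ≤ a) (L : ℕ) (hL : a + L ≤ M) : f (a + L) - f a ≤ L * (f (c + 1) - f c) := by
  induction L with
  | zero => simp
  | succ L ih =>
    have h1 := ih (by omega)
    have h2 := slope_anti hf (show c ≤ a + L by omega) (by omega)
    push_cast
    rw [← add_assoc]
    linarith

theorem mul_slope_le_increment {M : ℕ} {B : ℝ} {f : ℕ → ℝ} (hf : f ∈ concaveUpTo M B) {c : ℕ}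
    (hc : c < M) (L : ℕ) (hL : L ≤ c) : L * (f (c + 1) - f c) ≤ f L - f 0 := by
  induction L with
  | zero => simp
  | succ L ih =>
    have h1 := ih (by omega)
    have h2 := slope_anti hf (show L ≤ c by omega) (by omega)
    push_cast
    linarith

/-- The sequence that agrees with `f` up to `h` and has slope `-c` from there on. -/
noncomputable def extendBySlope (h : ℕ) (c : ℝ) (f : ℕ → ℝ) (k : ℕ) : ℝ :=
  f (min k h) - c * (k - h : ℕ)

theorem extendBySlope_of_le {h k : ℕ} (c : ℝ) (f : ℕ → ℝ) (hk : k ≤ h) :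
    extendBySlope h c f k = f k := by
  simp [extendBySlope, hk]

theorem extendBySlope_slope_of_lt {h k : ℕ} (c : ℝ) (f : ℕ → ℝ) (hk : k < h) :
    extendBySlope h c f (k + 1) - extendBySlope h c f k = f (k + 1) - f k := by
  rw [extendBySlope_of_le c f hk, extendBySlope_of_le c f hk.le]

theorem extendBySlope_slope_of_ge {h k : ℕ} (c : ℝ) (f : ℕ → ℝ) (hk : h ≤ k) :
    extendBySlope h c f (k + 1) - extendBySlope h c f k = -c := by
  rw [extendBySlope, extendBySlope, min_eq_right hk, min_eq_right (by omega),
    Nat.sub_add_comm hk]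
  push_cast; ring

/-- Slopes from `2 ^ i` on are at most `2B / 2 ^ i`, as `f` has climbed at least that steeply since
`0`; before `h` they are at least `-2B / h`, as `h` more steps follow. Continuing with slope `-2B /
h` thus keeps concavity when a dyadic block runs past `h`. -/
theorem extendBySlope_mem_steepConcave {M h i : ℕ} {B : ℝ} (hB : 0 ≤ B) (hh : 2 * h ≤ M)
    (hi : 2 ^ i ≤ h) {f : ℕ → ℝ} (hf : f ∈ concaveUpTo M B) :
    (fun k => extendBySlope h (2 * B / h) f (2 ^ i + k)) ∈ steepConcave i (2 * B) := by
  have hpos : 0 < h := lt_of_lt_of_le (by positivity) hi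
  have hposR : (0 : ℝ) < h := by exact_mod_cast hpos
  have hiR : (2 : ℝ) ^ i ≤ h := by exact_mod_cast hi
  have h2i : (0 : ℝ) < 2 ^ i := by positivity
  have lower : ∀ k < h, -(2 * B) ≤ h * (f (k + 1) - f k) := by
    intro k hk
    have := increment_le_mul_slope hf hk.le h (by omega)
    have := abs_le.1 (hf.2 (h + h) (by omega))
    have := abs_le.1 (hf.2 h (by omega))
    linarith
  refine ⟨?_, fun k => ?_, ?_⟩
  · have hanti : Antitone fun k => extendBySlope h (2 * B / h) f (k + 1) -
        extendBySlope h (2 * B / h) f k := by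
      refine antitone_nat_of_succ_le fun k => ?_
      rcases lt_trichotomy (k + 1) h with hk | hk | hk
      · rw [extendBySlope_slope_of_lt _ _ hk, extendBySlope_slope_of_lt _ _ (by omega)]
        exact hf.1 k (by omega)
      · rw [extendBySlope_slope_of_ge _ _ hk.ge, extendBySlope_slope_of_lt _ _ (by omega)]
        rw [← neg_div, div_le_iff₀ hposR]
        linarith [lower k (by omega)]
      · rw [extendBySlope_slope_of_ge _ _ hk.le, extendBySlope_slope_of_ge _ _ (by omega)]
    intro a b hab
    exact hanti (Nat.add_le_add_left hab _)
  · simp only [← add_assoc]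
    rcases lt_or_ge (2 ^ i + k) h with hk | hk
    · rw [extendBySlope_slope_of_lt _ _ hk]
      have h1 := lower _ hk
      have h2 := mul_slope_le_increment hf (c := 2 ^ i + k) (by omega) (2 ^ i) (by omega)
      have := abs_le.1 (hf.2 (2 ^ i) (by omega))
      have := abs_le.1 (hf.2 0 (by omega))
      push_cast at h2
      have habs : |f (2 ^ i + k + 1) - f (2 ^ i + k)| * 2 ^ i =
          |(f (2 ^ i + k + 1) - f (2 ^ i + k)) * 2 ^ i| := by rw [abs_mul, abs_of_pos h2i]
      rw [habs, abs_le]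
      refine ⟨?_, by linarith⟩
      rcases le_total 0 (f (2 ^ i + k + 1) - f (2 ^ i + k)) with h0 | h0
      · have := mul_nonneg h0 h2i.le
        linarith
      · have := mul_le_mul_of_nonpos_left hiR h0
        linarith
    · rw [extendBySlope_slope_of_ge _ _ hk, abs_neg, abs_of_nonneg (by positivity),
        div_mul_eq_mul_div, div_le_iff₀ hposR]
      gcongr
  · simp only [add_zero]
    rw [extendBySlope_of_le _ _ hi]
    have := hf.2 (2 ^ i) (by omega)
    linarith

theorem sum_range_two_pow (a : ℕ → ℝ) (I : ℕ) :
    ∑ k ∈ Finset.range (2 ^ I), a k =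
      a 0 + ∑ i ∈ Finset.range I, ∑ j ∈ Finset.range (2 ^ i), a (2 ^ i + j) := by
  induction I with
  | zero => simp
  | succ I ih =>
    rw [pow_succ, mul_two, Finset.sum_range_add, ih, Finset.sum_range_succ, add_assoc]

theorem hasCode_half {M n : ℕ} {B δ : ℝ} (hM : M < n) (hB : 0 ≤ B) (hδ : 0 < δ) :
    HasCode (concaveUpTo M B)
      (fun f f' => ∑ k ∈ Finset.range (M / 2 + 1), (f k - f' k) ^ 2 ≤ δ ^ 2)
      (440000 * √(B * √n / δ)) := by
  set h := M / 2 with hh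
  have hn1 : (1 : ℝ) ≤ n := by exact_mod_cast (by omega : 1 ≤ n)
  have hsn : 1 ≤ √(n : ℝ) := Real.one_le_sqrt.2 hn1
  set X := B * √n / δ with hX
  have hX0 : 0 ≤ X := by positivity
  -- `2 ^ (I - 1) ≤ h < 2 ^ I` for `h > 0`, so `0` and the blocks `[2 ^ i, 2 ^ (i + 1))`, `i < I`,
  -- cover `{0, …, h}`. With this `κ`, `2 * n * κ ^ 2 = δ ^ 2 / 8`.
  set I := Nat.size h with hI
  set κ := δ / (4 * √n) with hκ
  have hκ0 : 0 < κ := by positivity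
  set G := extendBySlope h (2 * B / h) with hG
  have e0 : HasCode (concaveUpTo M B) (fun f f' => |f 0 - f' 0| ≤ δ / 2) (4 * √X) := by
    refine (HasCode.of_abs_le (fun f : ℕ → ℝ => f 0) hB (half_pos hδ)
      fun f hf => hf.2 0 (by omega)).mono (fun _ _ _ _ h => h) ?_
    have : √(2 * B / (δ / 2)) ≤ 2 * √X := by
      rw [Real.sqrt_le_left (by positivity), mul_pow, Real.sq_sqrt hX0, hX]
      rw [show 2 * B / (δ / 2) = 2 ^ 2 * (B * 1 / δ) by field_simp]
      gcongr
    linarith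
  have e1 : ∀ i < I, HasCode (concaveUpTo M B)
      (fun f f' => ∀ k ≤ 2 ^ i, |G f (2 ^ i + k) - G f' (2 ^ i + k)| ≤ κ * (5 / 4) ^ (I - i))
      (14600 * 3 * √X * (9 / 10) ^ (I - i)) := by
    intro i hi
    have hi' : 2 ^ i ≤ h := Nat.lt_size.1 hi
    refine ((hasCode_steepConcave (n := i) (D := 2 * B) (η := κ * (5 / 4) ^ (I - i))
      (by positivity)).comap (A' := concaveUpTo M B) (fun f k => G f (2 ^ i + k)) fun f hf =>
        extendBySlope_mem_steepConcave hB (by omega) hi' hf).mono (fun _ _ _ _ h => h) ?_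
    -- Uses `8 ≤ 3 ^ 2` and `4/5 ≤ (9/10) ^ 2`.
    have : √(2 * B / (κ * (5 / 4) ^ (I - i))) ≤ 3 * √X * (9 / 10) ^ (I - i) := by
      rw [Real.sqrt_le_left (by positivity), mul_pow, mul_pow, Real.sq_sqrt hX0]
      have e : 2 * B / (κ * (5 / 4) ^ (I - i)) = 8 * X * (4 / 5) ^ (I - i) := by
        rw [show (4 / 5 : ℝ) = (5 / 4)⁻¹ by norm_num, inv_pow, hX, hκ]
        field_simp; ring
      rw [e, ← pow_mul, mul_comm (I - i) 2, pow_mul]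
      gcongr <;> norm_num
    linarith
  refine (e0.and (HasCode.forall_lt e1)).mono ?_ ?_
  · rintro f - f' - ⟨h0, h1⟩
    have hgeom := sum_pow_sub_le (ρ := 25 / 32) (by norm_num) (by norm_num) I
    norm_num at hgeom
    have hblock : ∀ i ∈ Finset.range I, ∑ j ∈ Finset.range (2 ^ i),
        (G f (2 ^ i + j) - G f' (2 ^ i + j)) ^ 2 ≤ δ ^ 2 / 8 * (25 / 32) ^ (I - i) := by
      intro i hi
      have hi := Finset.mem_range.1 hi
      have hIh : 2 ^ (I - 1) ≤ h := Nat.lt_size.1 (by omega)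
      have hIn : (2 : ℝ) ^ I ≤ 2 * n := by
        have : 2 ^ I ≤ 2 * n := by
          rw [show I = I - 1 + 1 by omega, pow_succ]; omega
        exact_mod_cast this
      calc _ ≤ ∑ j ∈ Finset.range (2 ^ i), (κ * (5 / 4) ^ (I - i)) ^ 2 := by
            refine Finset.sum_le_sum fun j hj => ?_
            rw [← sq_abs (G f _ - _)]
            have := h1 i hi j (Finset.mem_range.1 hj).le
            gcongr
        _ = 2 ^ I * κ ^ 2 * (25 / 32) ^ (I - i) := by
            have p1 : (2 : ℝ) ^ I = 2 ^ i * 2 ^ (I - i) := by rw [← pow_add]; congr 1; omega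
            have p2 : (25 / 32 : ℝ) ^ (I - i) = ((5 / 4) ^ (I - i)) ^ 2 / 2 ^ (I - i) := by
              rw [← pow_mul, mul_comm, pow_mul, ← div_pow]; norm_num
            rw [Finset.sum_const, Finset.card_range, nsmul_eq_mul, p1, p2]
            push_cast
            field_simp
        _ ≤ 2 * n * κ ^ 2 * (25 / 32) ^ (I - i) := by gcongr
        _ = _ := by
            rw [hκ, div_pow, mul_pow, Real.sq_sqrt (by positivity)]
            field_simp; norm_num
    have ha0 : (G f 0 - G f' 0) ^ 2 ≤ (δ / 2) ^ 2 := by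
      rw [hG, extendBySlope_of_le _ _ (Nat.zero_le _), extendBySlope_of_le _ _ (Nat.zero_le _),
        ← sq_abs]
      gcongr
    calc _ = ∑ k ∈ Finset.range (h + 1), (G f k - G f' k) ^ 2 := by
          refine Finset.sum_congr rfl fun k hk => ?_
          have := Finset.mem_range.1 hk
          rw [hG, extendBySlope_of_le _ _ (by omega), extendBySlope_of_le _ _ (by omega)]
      _ ≤ ∑ k ∈ Finset.range (2 ^ I), (G f k - G f' k) ^ 2 :=
          Finset.sum_le_sum_of_subset_of_nonneg
            (Finset.range_subset_range.2 (Nat.lt_size_self h)) fun _ _ _ => by positivity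
      _ ≤ (δ / 2) ^ 2 + ∑ i ∈ Finset.range I, δ ^ 2 / 8 * (25 / 32) ^ (I - i) := by
          rw [sum_range_two_pow]
          exact add_le_add ha0 (Finset.sum_le_sum hblock)
      _ ≤ δ ^ 2 := by
          rw [← Finset.mul_sum]
          have := mul_le_mul_of_nonneg_left hgeom (show 0 ≤ δ ^ 2 / 8 by positivity)
          nlinarith [sq_nonneg δ]
  · rw [← Finset.mul_sum]
    have hgeom := sum_pow_sub_le (ρ := 9 / 10) (by norm_num) (by norm_num) I
    norm_num at hgeom
    have := mul_le_mul_of_nonneg_left hgeom (show 0 ≤ 14600 * 3 * √X by positivity)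
    linarith [Real.sqrt_nonneg X]

theorem reverse_mem_concaveUpTo {M : ℕ} {B : ℝ} {f : ℕ → ℝ} (hf : f ∈ concaveUpTo M B) :
    (fun k => f (M - k)) ∈ concaveUpTo M B := by
  refine ⟨fun j hj => ?_, fun k _ => hf.2 _ (by omega)⟩
  have := hf.1 (M - (j + 2)) (by omega)
  rw [show M - (j + 2) + 2 = M - j by omega, show M - (j + 2) + 1 = M - (j + 1) by omega] at this
  simp only
  linarith

theorem sum_range_le_two_halves (M : ℕ) (a : ℕ → ℝ) (ha : ∀ k, 0 ≤ a k) :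
    ∑ k ∈ Finset.range (M + 1), a k ≤ ∑ k ∈ Finset.range (M / 2 + 1), a k +
      ∑ k ∈ Finset.range (M / 2 + 1), a (M - k) := by
  rw [show M + 1 = (M / 2 + 1) + (M - M / 2) by omega, Finset.sum_range_add,
    ← Finset.sum_range_reflect (fun k => a (M / 2 + 1 + k))]
  gcongr ?_ + ?_
  · rfl
  refine le_trans (le_of_eq (Finset.sum_congr rfl fun k hk => ?_))
    (Finset.sum_le_sum_of_subset_of_nonneg (Finset.range_subset_range.2
      (show M - M / 2 ≤ M / 2 + 1 by omega)) fun k _ _ => ha (M - k))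
  have := Finset.mem_range.1 hk
  congr 1
  omega

theorem hasCode_concaveUpTo {M n : ℕ} {B δ : ℝ} (hM : M < n) (hB : 0 ≤ B) (hδ : 0 < δ) :
    HasCode (concaveUpTo M B)
      (fun f f' => ∑ k ∈ Finset.range (M + 1), (f k - f' k) ^ 2 ≤ 2 * δ ^ 2)
      (880000 * √(B * √n / δ)) := by
  refine ((hasCode_half hM hB hδ).and ((hasCode_half hM hB hδ).comap (fun f k => f (M - k))
    fun f hf => reverse_mem_concaveUpTo hf)).mono ?_ (by linarith)
  rintro f - f' - ⟨h1, h2⟩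
  have := sum_range_le_two_halves M (fun k => (f k - f' k) ^ 2) fun _ => by positivity
  linarith

/-! ### Three blocks and the covering number -/

/-- Extension of a vector by zero to a sequence. -/
noncomputable def zeroExtend {n : ℕ} (θ : EuclideanSpace ℝ (Fin n)) (k : ℕ) : ℝ :=
  if h : k < n then θ ⟨k, h⟩ else 0

theorem zeroExtend_of_lt {n k : ℕ} (θ : EuclideanSpace ℝ (Fin n)) (h : k < n) :
    zeroExtend θ k = θ ⟨k, h⟩ := dif_pos h

theorem hasCode_block {n a ℓ : ℕ} (hℓ : a + ℓ ≤ n) {B δ : ℝ} (hB : 0 ≤ B) (hδ : 0 < δ) :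
    HasCode {θ : EuclideanSpace ℝ (Fin n) | seqBlock θ a ℓ hℓ ∈ concaveSeqs ℓ ∧ ∀ i, |θ i| ≤ B}
      (fun θ θ' => ∑ k ∈ Finset.range ℓ, (zeroExtend θ (a + k) - zeroExtend θ' (a + k)) ^ 2 ≤
        2 * δ ^ 2) (880000 * √(B * √n / δ)) := by
  rcases ℓ with _ | M
  · exact HasCode.of_forall (fun _ _ _ _ => by simp; positivity) (by positivity)
  · refine (hasCode_concaveUpTo (M := M) (n := n) (by omega) hB hδ).comap
      (fun θ k => zeroExtend θ (a + k)) ?_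
    rintro θ ⟨h1, h2⟩
    refine ⟨fun j hj => ?_, fun k hk => ?_⟩
    · have := h1 j (by omega)
      simp only [seqBlock] at this
      simp only
      rw [zeroExtend_of_lt θ (show a + (j + 2) < n by omega),
        zeroExtend_of_lt θ (show a + (j + 1) < n by omega),
        zeroExtend_of_lt θ (show a + j < n by omega)]
      exact this
    · simp only
      rw [zeroExtend_of_lt θ (show a + k < n by omega)]
      exact h2 _

theorem dist_sq_eq_sum_range {n : ℕ} (θ θ' : EuclideanSpace ℝ (Fin n)) :
    dist θ θ' ^ 2 = ∑ k ∈ Finset.range n, (zeroExtend θ k - zeroExtend θ' k) ^ 2 := by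
  rw [EuclideanSpace.dist_eq, Real.sq_sqrt (Finset.sum_nonneg fun _ _ => by positivity),
    ← Fin.sum_univ_eq_sum_range (fun k => (zeroExtend θ k - zeroExtend θ' k) ^ 2)]
  refine Finset.sum_congr rfl fun i _ => ?_
  rw [Real.dist_eq, sq_abs, zeroExtend_of_lt θ i.2, zeroExtend_of_lt θ' i.2]

/-- The bounded sequences with three concave blocks at prescribed positions. -/
def fixedBlockSeqs (n : ℕ) (B : ℝ) (m₁ m₂ : ℕ) : Set (EuclideanSpace ℝ (Fin n)) :=
  {θ | (∃ (_ : m₁ < m₂) (_ : m₂ ≤ n + 1),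
    seqBlock θ 0 m₁ (by omega) ∈ concaveSeqs m₁ ∧
    seqBlock θ m₁ (m₂ - m₁ - 1) (by omega) ∈ concaveSeqs (m₂ - m₁ - 1) ∧
    seqBlock θ (m₂ - 1) (n + 1 - m₂) (by omega) ∈ concaveSeqs (n + 1 - m₂)) ∧ ∀ i, |θ i| ≤ B}

theorem hasCode_fixedBlockSeqs {n : ℕ} (m₁ m₂ : ℕ) {B ε : ℝ} (hB : 0 ≤ B) (hε : 0 < ε) :
    HasCode (fixedBlockSeqs n B m₁ m₂) (fun θ θ' => dist θ θ' ≤ ε)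
      (5280000 * √(B * √n / ε)) := by
  by_cases hm : m₁ < m₂ ∧ m₂ ≤ n + 1
  · obtain ⟨h1, h2⟩ := hm
    -- Three squared block errors of `2 * (ε / 3) ^ 2` add up to less than `ε ^ 2`.
    have hδ : 0 < ε / 3 := by positivity
    have c1 := (hasCode_block (n := n) (a := 0) (ℓ := m₁) (by omega) hB hδ).comap
      (A' := fixedBlockSeqs n B m₁ m₂) id fun θ hθ => ⟨hθ.1.2.2.1, hθ.2⟩
    have c2 := (hasCode_block (n := n) (a := m₁) (ℓ := m₂ - m₁ - 1) (by omega) hB hδ).comap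
      (A' := fixedBlockSeqs n B m₁ m₂) id fun θ hθ => ⟨hθ.1.2.2.2.1, hθ.2⟩
    have c3 := (hasCode_block (n := n) (a := m₂ - 1) (ℓ := n + 1 - m₂) (by omega) hB hδ).comap
      (A' := fixedBlockSeqs n B m₁ m₂) id fun θ hθ => ⟨hθ.1.2.2.2.2, hθ.2⟩
    refine ((c1.and c2).and c3).mono ?_ ?_
    · rintro θ - θ' - ⟨⟨h3, h4⟩, h5⟩
      simp only [id, zero_add] at h3 h4 h5
      refine abs_le_of_sq_le_sq' ?_ hε.le |>.2
      rw [dist_sq_eq_sum_range]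
      have split := fun F : ℕ → ℝ => Finset.sum_range_add F (m₁ + (m₂ - m₁ - 1)) (n + 1 - m₂)
      rw [show m₁ + (m₂ - m₁ - 1) + (n + 1 - m₂) = n by omega] at split
      rw [split, Finset.sum_range_add, show m₁ + (m₂ - m₁ - 1) = m₂ - 1 by omega]
      nlinarith [sq_nonneg ε]
    · have : √(B * √n / (ε / 3)) ≤ 2 * √(B * √n / ε) := by
        rw [Real.sqrt_le_left (by positivity), mul_pow, Real.sq_sqrt (by positivity),
          show B * √n / (ε / 3) = 3 * (B * √n / ε) by field_simp]
        gcongr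
        norm_num
      linarith
  -- Inconsistent positions: the set is empty.
  · exact HasCode.of_forall (fun θ hθ => absurd ⟨hθ.1.1, hθ.1.2.1⟩ hm) (by positivity)

theorem HasCode.exists_cover {E : Type*} [PseudoMetricSpace E] {A : Set E} {ε : ℝ≥0} {H : ℝ}
    (h : HasCode A (fun x y => dist x y ≤ ε) H) :
    ∃ C : Finset E, (C : Set E) ⊆ A ∧ Metric.IsCover ε A C ∧ (C.card : ℝ) ≤ Real.exp H := by
  classical
  obtain ⟨ι, S, c, hc, hS, hcR⟩ := h
  have hfin : (c '' A).Finite := S.finite_toSet.subset (by rintro _ ⟨x, hx, rfl⟩; exact hc x hx)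
  have hcard : hfin.toFinset.card ≤ S.card := Finset.card_le_card fun i hi => by
    obtain ⟨x, hx, rfl⟩ := hfin.mem_toFinset.1 hi
    exact hc x hx
  have hrep : ∀ i : hfin.toFinset, ∃ x ∈ A, c x = i := fun i => hfin.mem_toFinset.1 i.2
  choose p hpA hpc using hrep
  refine ⟨Finset.univ.image p, ?_, ?_, ?_⟩
  · intro x hx
    obtain ⟨i, -, rfl⟩ := Finset.mem_image.1 (Finset.mem_coe.1 hx)
    exact hpA i
  · intro x hx
    have hi : c x ∈ hfin.toFinset := hfin.mem_toFinset.2 ⟨x, hx, rfl⟩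
    refine ⟨p ⟨c x, hi⟩, by simp, ?_⟩
    exact edist_le_coe.2 (hcR x hx _ (hpA ⟨c x, hi⟩) (hpc ⟨c x, hi⟩).symm)
  · refine le_trans ?_ hS
    have : (Finset.univ.image p).card ≤ S.card :=
      Finset.card_image_le.trans (by simpa using hcard)
    exact_mod_cast this

theorem exists_cover_boundedThreeBlockConcaveSeqs (n : ℕ) {B : ℝ} (hB : 0 ≤ B) {ε : ℝ≥0}
    (hε : 0 < ε) :
    ∃ C : Finset (EuclideanSpace ℝ (Fin n)),
      (C : Set (EuclideanSpace ℝ (Fin n))) ⊆ boundedThreeBlockConcaveSeqs n B ∧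
      Metric.IsCover ε (boundedThreeBlockConcaveSeqs n B) C ∧
      (C.card : ℝ) ≤ (n + 2) ^ 2 * Real.exp (5280000 * √(B * √n / ε)) := by
  classical
  choose C hCA hC hcard using fun p : Fin (n + 2) × Fin (n + 2) =>
    (hasCode_fixedBlockSeqs (n := n) p.1 p.2 hB (NNReal.coe_pos.2 hε)).exists_cover
  refine ⟨Finset.univ.biUnion C, ?_, ?_, ?_⟩
  · intro θ hθ
    obtain ⟨p, -, hp⟩ := Finset.mem_biUnion.1 (Finset.mem_coe.1 hθ)
    obtain ⟨⟨h1, h2, h3⟩, h4⟩ := hCA p hp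
    exact ⟨⟨p.1, p.2, h1, h2, h3⟩, h4⟩
  · rintro θ ⟨⟨m₁, m₂, h1, h2, h3⟩, h4⟩
    obtain ⟨θ', hθ', hd⟩ := hC (⟨m₁, by omega⟩, ⟨m₂, by omega⟩) ⟨⟨h1, h2, h3⟩, h4⟩
    exact ⟨θ', Finset.mem_coe.2 (Finset.mem_biUnion.2 ⟨_, Finset.mem_univ _, hθ'⟩), hd⟩
  · calc ((Finset.univ.biUnion C).card : ℝ) ≤ ∑ p, ((C p).card : ℝ) := by
          exact_mod_cast Finset.card_biUnion_le
      _ ≤ ∑ _p : Fin (n + 2) × Fin (n + 2), Real.exp (5280000 * √(B * √n / ε)) :=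
          Finset.sum_le_sum fun p _ => hcard p
      _ = _ := by
          rw [Finset.sum_const, Finset.card_univ, Fintype.card_prod, Fintype.card_fin,
            nsmul_eq_mul]
          push_cast; ring

theorem lemma3p7 :
    ∃ C : ℝ, 0 < C ∧
      ∀ (n : ℕ) (_ : 1 ≤ n) (B : ℝ) (_ : 0 ≤ B) (ε : ℝ≥0) (_ : 0 < ε),
        Metric.coveringNumber ε (boundedThreeBlockConcaveSeqs n B) ≠ ⊤ ∧
        Real.log ((Metric.coveringNumber ε (boundedThreeBlockConcaveSeqs n B)).toNat : ℝ) ≤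
          C * (n : ℝ) ^ (1 / 4 : ℝ) * (B / (ε : ℝ)) ^ (1 / 2 : ℝ) +
            2 * Real.log ((n : ℝ) + 2) := by
  refine ⟨5280000, by norm_num, fun n _ B hB ε hε => ?_⟩
  have hεR : (0 : ℝ) < ε := NNReal.coe_pos.2 hε
  obtain ⟨C, hCA, hC, hcard⟩ := exists_cover_boundedThreeBlockConcaveSeqs n hB hε
  have hle := hC.coveringNumber_le_encard hCA
  rw [Set.encard_coe_eq_coe_finsetCard] at hle
  refine ⟨ne_top_of_le_ne_top (ENat.natCast_ne_top _) hle, ?_⟩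
  have hnat : (Metric.coveringNumber ε (boundedThreeBlockConcaveSeqs n B)).toNat ≤ C.card := by
    simpa using ENat.toNat_le_toNat hle (ENat.natCast_ne_top _)
  have hsqrt : √(B * √n / ε) = (n : ℝ) ^ (1 / 4 : ℝ) * (B / (ε : ℝ)) ^ (1 / 2 : ℝ) := by
    rw [show B * √n / ε = √n * (B / ε) by ring, Real.sqrt_mul (by positivity),
      Real.sqrt_eq_rpow (B / ε), Real.sqrt_eq_rpow (√n), Real.sqrt_eq_rpow,
      ← Real.rpow_mul (by positivity)]
    norm_num
  rw [mul_assoc, ← hsqrt]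
  rcases Nat.eq_zero_or_pos
    (Metric.coveringNumber ε (boundedThreeBlockConcaveSeqs n B)).toNat with h0 | h0
  -- As `Real.log 0 = 0`, only nonnegativity of the bound is needed.
  · rw [h0, Nat.cast_zero, Real.log_zero]
    have := Real.log_nonneg (show (1 : ℝ) ≤ n + 2 by linarith [n.cast_nonneg (α := ℝ)])
    positivity
  · refine (Real.log_le_log (by exact_mod_cast h0)
      ((Nat.cast_le.2 hnat).trans hcard)).trans (le_of_eq ?_)
    rw [Real.log_mul (by positivity) (Real.exp_ne_zero _), Real.log_exp, Real.log_pow]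
    push_cast; ring
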